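/- **Proposition (Stability of exponential reweighting in $W_1$).** Let $(E,d)$ be a metric space with $d(x,y)\le D<\infty$ for all $x,y\in E$, equipped with its Borel $\sigma$-algebra. Let $\Phi:E\to\mathbb{R}^k$ satisfy $\|\Phi(x)\|_2\le R$ for all $x$, with $R>0$, and $\|\Phi(x)-\Phi(y)\|_2\le L_\Phi\, d(x,y)$ for all $x,y$. Let $P_X$ be a Borel probability measure on $E$, let $X_1,\dots,X_n\in E$ (source sample, $n\ge1$) and $Z_1,\dots,Z_m\in E$ (target sample, $m\ge 1$), and put $$\hat P_n=\frac1n\sum_{i=1}^n\delta_{X_i},\qquad \hat\mu_{Q,m}=\frac1m\sum_{j=1}^m\Phi(Z_j).$$ For a probability measure $P$ on $E$ let $H_P(\xi)=\log\int_E e^{\langle\xi,\Phi\rangle}\,dP$. Let $\Xi\subset\mathbb{R}^k$ be bounded, and suppose that $\hat\xi^*\in\Xi$ is an empirical dual parameter, i.e. a minimizer over $\mathbb{R}^k$ of $\xi\mapsto H_{\hat P_n}(\xi)-\langle\xi,\hat\mu_{Q,m}\rangle$. Let $P_{\hat\xi^*}$ be the tilted measure with $$\frac{dP_{\hat\xi^*}}{dP_X}(x)=\exp\bigl(\langle\hat\xi^*,\Phi(x)\rangle-H_{P_X}(\hat\xi^*)\bigr),$$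 and let $\hat P^*_{n,w}$ be the discrete solution of entropic projection alignment (EPA), i.e. a minimizer of $\mathrm{KL}(\tilde P\,\|\,\hat P_n)$ over all probability measures $\tilde P\ll\hat P_n$ with $\int\Phi\,d\tilde P=\hat\mu_{Q,m}$. Set $$B_\Xi=\sup_{\xi\in\Xi}\|\xi\|_2,\quad m_\Xi=e^{-B_\Xi R},\quad M_\Xi=e^{B_\Xi R},\quad L_w=B_\Xi L_\Phi e^{B_\Xi R}.$$ Then $$W_1(P_{\hat\xi^*},\hat P^*_{n,w})\le C_{\Xi,\Phi,D}\,W_1(P_X,\hat P_n),\qquad C_{\Xi,\Phi,D}=\frac{M_\Xi+D L_w}{m_\Xi}+\frac{D M_\Xi L_w}{m_\Xi^2},$$ where $W_1(\mu,\nu)=\inf_\pi\int d(x,y)\,\pi(dx,dy)$, the infimum being over all couplings $\pi$ of $\mu$ and $\nu$. -/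

import Mathlib

open MeasureTheory InformationTheory
open scoped ENNReal NNReal RealInnerProductSpace

noncomputable section

namespace EPA

/-- The couplings of `μ` and `ν`: measures on the product with marginals `μ` and `ν`. -/
def couplings {E : Type*} [MeasurableSpace E] (μ ν : Measure E) : Set (Measure (E × E)) :=
  {π | π.map Prod.fst = μ ∧ π.map Prod.snd = ν}

/-- The Wasserstein distance of order one, as the optimal transport cost for the metric:
the infimum over all couplings of the integral of the distance. The integrand is jointly
measurable if `E` is separable, and it agrees almost everywhere with a measurable function for
every coupling if one of the two marginals is finitely supported. -/
def W1 {E : Type*} [MeasurableSpace E] [MetricSpace E] (μ ν : Measure E) : ℝ≥0∞ :=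
  ⨅ π ∈ couplings μ ν, ∫⁻ z, edist z.1 z.2 ∂π

/-- The empirical measure `(1/n) ∑ i, δ_{X i}` of a sample. -/
def empiricalMeasure {E : Type*} [MeasurableSpace E] {n : ℕ} (X : Fin n → E) : Measure E :=
  (n : ℝ≥0∞)⁻¹ • ∑ i, Measure.dirac (X i)

/-- The empirical moment `(1/m) ∑ j, Φ (Z j)` of the feature map over a sample. -/
def empiricalMoment {E : Type*} {k m : ℕ} (Φ : E → EuclideanSpace ℝ (Fin k)) (Z : Fin m → E) :
    EuclideanSpace ℝ (Fin k) :=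
  (m : ℝ)⁻¹ • ∑ j, Φ (Z j)

/-- The log-partition function `H_P(ξ) = log 𝔼_P[exp ⟪ξ, Φ⟫]`. -/
def logPartition {E : Type*} [MeasurableSpace E] {k : ℕ} (P : Measure E)
    (Φ : E → EuclideanSpace ℝ (Fin k)) (ξ : EuclideanSpace ℝ (Fin k)) : ℝ :=
  Real.log (∫ x, Real.exp ⟪ξ, Φ x⟫ ∂P)

/-- `ξ` is a dual parameter for the reference measure `P` and the moment vector `t`: it minimizes
the dual objective `H_P(ξ) - ⟪ξ, t⟫` over the whole space. -/
def IsDualParameter {E : Type*} [MeasurableSpace E] {k : ℕ} (P : Measure E)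
    (Φ : E → EuclideanSpace ℝ (Fin k)) (t ξ : EuclideanSpace ℝ (Fin k)) : Prop :=
  ∀ η : EuclideanSpace ℝ (Fin k), logPartition P Φ ξ - ⟪ξ, t⟫ ≤ logPartition P Φ η - ⟪η, t⟫

/-- The member with parameter `ξ` of the exponential family generated by `P` and `Φ`: the measure
with density `exp (⟪ξ, Φ x⟫ - H_P(ξ)) = exp ⟪ξ, Φ x⟫ / 𝔼_P[exp ⟪ξ, Φ⟫]` with respect to `P`. -/
def tiltedModel {E : Type*} [MeasurableSpace E] {k : ℕ} (P : Measure E)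
    (Φ : E → EuclideanSpace ℝ (Fin k)) (ξ : EuclideanSpace ℝ (Fin k)) : Measure E :=
  P.withDensity fun x => ENNReal.ofReal (Real.exp (⟪ξ, Φ x⟫ - logPartition P Φ ξ))

/-- The probability measures absolutely continuous with respect to `P` for which `Φ` has
mean `t`. -/
def feasible {E : Type*} [MeasurableSpace E] {k : ℕ} (P : Measure E)
    (Φ : E → EuclideanSpace ℝ (Fin k)) (t : EuclideanSpace ℝ (Fin k)) : Set (Measure E) :=
  {Q | IsProbabilityMeasure Q ∧ Q ≪ P ∧ Integrable Φ Q ∧ ∫ x, Φ x ∂Q = t}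

/-- `Pstar` is an entropic projection of `P`: it minimizes `KL(Q ‖ P)` over all probability
measures `Q ≪ P` with `𝔼_Q[Φ] = t`. -/
def IsEntropicProjection {E : Type*} [MeasurableSpace E] {k : ℕ} (P : Measure E)
    (Φ : E → EuclideanSpace ℝ (Fin k)) (t : EuclideanSpace ℝ (Fin k)) (Pstar : Measure E) :
    Prop :=
  Pstar ∈ feasible P Φ t ∧ ∀ Q ∈ feasible P Φ t, klDiv Pstar P ≤ klDiv Q P

/-- `B_Ξ`, the supremum of the Euclidean norm over the parameter set. -/
def paramBound {k : ℕ} (Ξ : Set (EuclideanSpace ℝ (Fin k))) : ℝ :=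
  sSup ((fun ξ => ‖ξ‖) '' Ξ)

/-- `m_Ξ = exp (-B_Ξ R)`. -/
def lowerWeight {k : ℕ} (Ξ : Set (EuclideanSpace ℝ (Fin k))) (R : ℝ) : ℝ :=
  Real.exp (-(paramBound Ξ * R))

/-- `M_Ξ = exp (B_Ξ R)`. -/
def upperWeight {k : ℕ} (Ξ : Set (EuclideanSpace ℝ (Fin k))) (R : ℝ) : ℝ :=
  Real.exp (paramBound Ξ * R)

/-- `L_w = B_Ξ L_Φ exp (B_Ξ R)`. -/
def weightLip {k : ℕ} (Ξ : Set (EuclideanSpace ℝ (Fin k))) (R : ℝ) (LΦ : ℝ≥0) : ℝ :=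
  paramBound Ξ * LΦ * Real.exp (paramBound Ξ * R)

/-- `C_{Ξ,Φ,D} = (M_Ξ + D L_w) / m_Ξ + D M_Ξ L_w / m_Ξ ^ 2`. -/
def stabilityConst {k : ℕ} (Ξ : Set (EuclideanSpace ℝ (Fin k))) (R : ℝ) (LΦ : ℝ≥0) (D : ℝ) : ℝ :=
  (upperWeight Ξ R + D * weightLip Ξ R LΦ) / lowerWeight Ξ R
    + D * upperWeight Ξ R * weightLip Ξ R LΦ / lowerWeight Ξ R ^ 2

end EPA

end

namespace EPA

/-! ### Reweighting of couplings and its transport cost. -/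

section Coupling

variable {E : Type*} [MeasurableSpace E]

/-! Both measures in the conclusion are the same exponential reweighting, applied to `PX` and to the
empirical measure P. For the projection this is duality: stationarity of the dual objective gives
the tilted measure T the required mean, and every feasible Q of finite divergence satisfies KL(Q‖T)
= KL(Q‖P) - KL(T‖P), so a minimizer has KL(Q‖T) = 0 (`IsEntropicProjection.eq_tiltedModel`).

What remains is stability of reweighting. Given a coupling π of the base measures and new densities
α, β, the mass min(α(x), β(y)) π stays on its old route, at cost at most sup α times that of π. The
excess is transported arbitrarily, at cost at most D per unit of mass
(`exists_mem_couplings_withDensity`). The excess mass is the mean of the positive part of α(x) -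
β(y); the Lipschitz bound on the weight, used once for the numerators and once for the normalizing
constants, bounds it by a multiple of the cost of π (`W1_withDensity_normalized_le`). -/

theorem map_withDensity_comp {F : Type*} [MeasurableSpace F] {π : Measure F} {f : F → E}
    (hf : Measurable f) {α : E → ℝ≥0∞} (hα : Measurable α) :
    (π.withDensity fun z => α (f z)).map f = (π.map f).withDensity α := by
  ext s hs
  rw [Measure.map_apply hf hs, withDensity_apply _ (hf hs), withDensity_apply _ hs,
    setLIntegral_map hs hα hf]

theorem isProbabilityMeasure_of_mem_couplings {μ ν : Measure E} [IsProbabilityMeasure μ]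
    {π : Measure (E × E)} (hπ : π ∈ couplings μ ν) : IsProbabilityMeasure π := by
  have : IsProbabilityMeasure (π.map Prod.fst) := by rw [hπ.1]; infer_instance
  exact Measure.isProbabilityMeasure_of_map Prod.fst

/-- Reweighting a coupling: the common part `min (α x) (β y)` of the two densities is transported
as before, the two residual marginals are coupled independently. -/
theorem exists_mem_couplings_withDensity [MetricSpace E] {D : ℝ} (hD : ∀ x y : E, dist x y ≤ D)
    {μ ν : Measure E} {π : Measure (E × E)} (hπ : π ∈ couplings μ ν)
    {α β : E → ℝ≥0∞} (hα : Measurable α) (hβ : Measurable β)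
    (hα1 : ∫⁻ x, α x ∂μ = 1) (hβ1 : ∫⁻ x, β x ∂ν = 1) {A : ℝ≥0∞} (hA : ∀ x, α x ≤ A) :
    ∃ π' ∈ couplings (μ.withDensity α) (ν.withDensity β),
      ∫⁻ z, edist z.1 z.2 ∂π' ≤
        A * ∫⁻ z, edist z.1 z.2 ∂π
          + ENNReal.ofReal D * ∫⁻ z, (α z.1 - β z.2) ∂π := by
  obtain ⟨hfst, hsnd⟩ := hπ
  have hα' : Measurable fun z : E × E => α z.1 := hα.comp measurable_fst
  have hβ' : Measurable fun z : E × E => β z.2 := hβ.comp measurable_snd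
  have hmin : Measurable fun z : E × E => min (α z.1) (β z.2) := hα'.min hβ'
  set γ := π.withDensity fun z => min (α z.1) (β z.2) with hγ
  set σ₁ := π.withDensity fun z => α z.1 - β z.2 with hσ₁
  set σ₂ := π.withDensity fun z => β z.2 - α z.1 with hσ₂
  have hsum₁ : γ + σ₁ = π.withDensity fun z => α z.1 := by
    rw [hγ, hσ₁, ← withDensity_add_left hmin]
    congr 1
    funext z
    simp only [Pi.add_apply]
    rcases le_total (α z.1) (β z.2) with h | h
    · simp [h, tsub_eq_zero_of_le h]
    · simp [h]
  have hsum₂ : γ + σ₂ = π.withDensity fun z => β z.2 := by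
    rw [hγ, hσ₂, ← withDensity_add_left hmin]
    congr 1
    funext z
    simp only [Pi.add_apply]
    rcases le_total (α z.1) (β z.2) with h | h
    · simp [h]
    · simp [h, tsub_eq_zero_of_le h]
  have htot₁ : γ Set.univ + σ₁ Set.univ = 1 := by
    rw [← Measure.add_apply, hsum₁, withDensity_apply _ .univ, setLIntegral_univ, ← hα1, ← hfst,
      lintegral_map hα measurable_fst]
  have htot₂ : γ Set.univ + σ₂ Set.univ = 1 := by
    rw [← Measure.add_apply, hsum₂, withDensity_apply _ .univ, setLIntegral_univ, ← hβ1, ← hsnd,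
      lintegral_map hβ measurable_snd]
  have hγtop : γ Set.univ ≠ ∞ := ne_top_of_le_ne_top ENNReal.one_ne_top (htot₁ ▸ le_self_add)
  have hδ : σ₂ Set.univ = σ₁ Set.univ := by
    rw [← ENNReal.add_right_inj hγtop, htot₁, htot₂]
  have hδtop : σ₁ Set.univ ≠ ∞ := ne_top_of_le_ne_top ENNReal.one_ne_top (htot₁ ▸ le_add_self)
  have : IsFiniteMeasure σ₁ := ⟨hδtop.lt_top⟩
  have : IsFiniteMeasure σ₂ := ⟨(hδ ▸ hδtop).lt_top⟩
  set ρ₁ := σ₁.map Prod.fst with hρ₁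
  set ρ₂ := σ₂.map Prod.snd with hρ₂
  set δ := σ₁ Set.univ with hδdef
  have hρ₁u : ρ₁ Set.univ = δ := by rw [hρ₁, Measure.map_apply measurable_fst .univ]; rfl
  have hρ₂u : ρ₂ Set.univ = δ := by rw [hρ₂, Measure.map_apply measurable_snd .univ, ← hδ]; rfl
  -- For δ = 0 the factor δ⁻¹ is ∞, but then ρ = 0, so no separate case is needed below.
  have hnorm : ∀ ρ : Measure E, ρ Set.univ = δ → δ⁻¹ • δ • ρ = ρ := by
    intro ρ hρ
    rcases eq_or_ne δ 0 with h0 | h0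
    · rw [h0, Measure.measure_univ_eq_zero] at hρ
      simp [hρ]
    · rw [smul_smul, ENNReal.inv_mul_cancel h0 hδtop, one_smul]
  -- Both residuals have mass δ, so each marginal of their product carries an extra factor δ, which
  -- δ⁻¹ removes.
  refine ⟨γ + δ⁻¹ • ρ₁.prod ρ₂, ⟨?_, ?_⟩, ?_⟩
  · rw [Measure.map_add _ _ measurable_fst, Measure.map_smul, Measure.map_fst_prod, hρ₂u,
      hnorm _ hρ₁u, hρ₁, ← Measure.map_add _ _ measurable_fst, hsum₁,
      map_withDensity_comp measurable_fst hα, hfst]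
  · rw [Measure.map_add _ _ measurable_snd, Measure.map_smul, Measure.map_snd_prod, hρ₁u,
      hnorm _ hρ₂u, hρ₂, ← Measure.map_add _ _ measurable_snd, hsum₂,
      map_withDensity_comp measurable_snd hβ, hsnd]
  · rw [lintegral_add_measure, lintegral_smul_measure]
    refine add_le_add ?_ ?_
    · have hle : γ ≤ A • π := by
        rw [← withDensity_const]
        exact withDensity_mono (ae_of_all _ fun z => (min_le_left _ _).trans (hA _))
      calc ∫⁻ z, edist z.1 z.2 ∂γ ≤ ∫⁻ z, edist z.1 z.2 ∂(A • π) := lintegral_mono' hle le_rfl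
        _ = A * ∫⁻ z, edist z.1 z.2 ∂π := by rw [lintegral_smul_measure, smul_eq_mul]
    · have hδint : ∫⁻ z, (α z.1 - β z.2) ∂π = δ := by
        rw [hδdef, hσ₁, withDensity_apply _ .univ, setLIntegral_univ]
      calc δ⁻¹ • ∫⁻ z, edist z.1 z.2 ∂(ρ₁.prod ρ₂)
          ≤ δ⁻¹ • ∫⁻ _, ENNReal.ofReal D ∂(ρ₁.prod ρ₂) := by
            gcongr with z
            rw [edist_dist]
            exact ENNReal.ofReal_le_ofReal (hD _ _)
        _ = ENNReal.ofReal D * (δ⁻¹ * δ * δ) := by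
            rw [lintegral_const, ← Set.univ_prod_univ, Measure.prod_prod, hρ₁u, hρ₂u, smul_eq_mul]
            ring
        _ ≤ ENNReal.ofReal D * ∫⁻ z, (α z.1 - β z.2) ∂π := by
            rw [hδint]
            gcongr
            exact mul_le_of_le_one_left' (ENNReal.inv_mul_le_one _)

/-- Stability in `W1` of normalized reweighting by a Lipschitz weight between `a > 0` and `b`. -/
theorem W1_withDensity_normalized_le [MetricSpace E] {D : ℝ} (hD : ∀ x y : E, dist x y ≤ D)
    {μ ν : Measure E} [IsProbabilityMeasure μ] [IsProbabilityMeasure ν]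
    {w : E → ℝ} (hw : Measurable w) {a b L : ℝ} (ha : 0 < a) (haw : ∀ x, a ≤ w x)
    (hwb : ∀ x, w x ≤ b) (hL : 0 ≤ L) (hLip : ∀ x y, |w x - w y| ≤ L * dist x y) :
    W1 (μ.withDensity fun x => ENNReal.ofReal (w x / ∫ y, w y ∂μ))
        (ν.withDensity fun x => ENNReal.ofReal (w x / ∫ y, w y ∂ν)) ≤
      ENNReal.ofReal ((b + D * L) / a + D * b * L / a ^ 2) * W1 μ ν := by
  have hne : Nonempty E := nonempty_of_isProbabilityMeasure μ
  obtain ⟨x₀⟩ := hne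
  have hD0 : 0 ≤ D := dist_nonneg.trans (hD x₀ x₀)
  have hb : 0 < b := ha.trans_le ((haw x₀).trans (hwb x₀))
  have hw0 : ∀ x, 0 ≤ w x := fun x => ha.le.trans (haw x)
  have hint : ∀ (P : Measure E) [IsProbabilityMeasure P], Integrable w P := fun P _ =>
    Integrable.of_mem_Icc a b hw.aemeasurable (ae_of_all _ fun x => ⟨haw x, hwb x⟩)
  have hmean : ∀ (P : Measure E) [IsProbabilityMeasure P], a ≤ ∫ x, w x ∂P := fun P _ => by
    simpa using integral_mono (integrable_const a) (hint P) haw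
  have hmass : ∀ (P : Measure E) [IsProbabilityMeasure P],
      ∫⁻ x, ENNReal.ofReal (w x / ∫ y, w y ∂P) ∂P = 1 := fun P _ => by
    rw [← ofReal_integral_eq_lintegral_ofReal ((hint P).div_const _)
      (ae_of_all _ fun x => div_nonneg (hw0 x) (ha.le.trans (hmean P))), integral_div,
      div_self (ha.trans_le (hmean P)).ne', ENNReal.ofReal_one]
  set c := ENNReal.ofReal ((b + D * L) / a + D * b * L / a ^ 2) with hc
  -- A nonzero constant is needed to move it inside the infimum: the inner infimum is ∞ when π is
  -- not a coupling, and 0 * ∞ = 0.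
  rcases eq_or_ne c 0 with hc0 | hc0
  · exfalso
    have : 0 < (b + D * L) / a + D * b * L / a ^ 2 := by positivity
    rw [hc, ENNReal.ofReal_eq_zero] at hc0
    exact absurd hc0 (not_le.2 this)
  unfold W1
  rw [ENNReal.mul_iInf' (fun h => absurd h ENNReal.ofReal_ne_top) (fun h => absurd h hc0)]
  refine le_iInf fun π => ?_
  rw [ENNReal.mul_iInf' (fun h => absurd h ENNReal.ofReal_ne_top) (fun h => absurd h hc0)]
  refine le_iInf fun hπ => ?_
  have := isProbabilityMeasure_of_mem_couplings hπ
  set I := ∫⁻ z, edist z.1 z.2 ∂π with hI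
  set p := ∫ y, w y ∂μ with hp
  set q := ∫ y, w y ∂ν with hq
  have hap : a ≤ p := hmean μ
  have haq : a ≤ q := hmean ν
  obtain ⟨π', hπ', hle⟩ := exists_mem_couplings_withDensity hD hπ
    (α := fun x => ENNReal.ofReal (w x / p)) (β := fun x => ENNReal.ofReal (w x / q))
    (hw.div_const _).ennreal_ofReal (hw.div_const _).ennreal_ofReal (hmass μ) (hmass ν)
    (A := ENNReal.ofReal (b / a)) (fun x => by
      refine ENNReal.ofReal_le_ofReal ?_
      have := hwb x
      gcongr)
  refine (iInf₂_le π' hπ').trans (hle.trans ?_)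
  have hpt : ∀ z : E × E, ‖w z.1 - w z.2‖ₑ ≤ ENNReal.ofReal L * edist z.1 z.2 := fun z => by
    rw [← ofReal_norm, Real.norm_eq_abs, edist_dist, ← ENNReal.ofReal_mul hL]
    exact ENNReal.ofReal_le_ofReal (hLip _ _)
  have hvar : ∫⁻ z : E × E, ‖w z.1 - w z.2‖ₑ ∂π ≤ ENNReal.ofReal L * I := by
    -- The distance need not be jointly measurable; finiteness of the constant suffices to pull it
    -- out.
    rw [hI, ← lintegral_const_mul' _ _ ENNReal.ofReal_ne_top]
    exact lintegral_mono hpt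
  have hpq : ‖p - q‖ₑ ≤ ENNReal.ofReal L * I := by
    have h1 : p = ∫ z, w z.1 ∂π := by
      rw [hp, ← hπ.1, integral_map measurable_fst.aemeasurable hw.aestronglyMeasurable]
    have h2 : q = ∫ z, w z.2 ∂π := by
      rw [hq, ← hπ.2, integral_map measurable_snd.aemeasurable hw.aestronglyMeasurable]
    have i1 : Integrable (fun z : E × E => w z.1) π :=
      Integrable.of_mem_Icc a b (hw.comp measurable_fst).aemeasurable
        (ae_of_all _ fun z => ⟨haw z.1, hwb z.1⟩)
    have i2 : Integrable (fun z : E × E => w z.2) π :=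
      Integrable.of_mem_Icc a b (hw.comp measurable_snd).aemeasurable
        (ae_of_all _ fun z => ⟨haw z.2, hwb z.2⟩)
    rw [h1, h2, ← integral_sub i1 i2]
    exact (enorm_integral_le_lintegral_enorm _).trans hvar
  have hdiff : ∀ x y : E, ENNReal.ofReal (w x / p) - ENNReal.ofReal (w y / q) ≤
      ENNReal.ofReal (1 / a) * ‖w x - w y‖ₑ + ENNReal.ofReal (b / a ^ 2) * ‖p - q‖ₑ := by
    intro x y
    have hp0 : 0 < p := ha.trans_le hap
    have hq0 : 0 < q := ha.trans_le haq
    rw [← ENNReal.ofReal_sub _ (div_nonneg (hw0 y) hq0.le), ← ofReal_norm,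
      ← ofReal_norm, Real.norm_eq_abs, Real.norm_eq_abs,
      ← ENNReal.ofReal_mul (by positivity), ← ENNReal.ofReal_mul (by positivity),
      ← ENNReal.ofReal_add (by positivity) (by positivity)]
    refine ENNReal.ofReal_le_ofReal ?_
    -- The first term compares the weights, the second the normalizing constants.
    have e : w x / p - w y / q = (1 / p) * (w x - w y) + (w y / (p * q)) * (q - p) := by
      field_simp
      ring
    rw [e]
    have h1 : (1 / p) * (w x - w y) ≤ 1 / a * |w x - w y| := by
      refine (mul_le_mul_of_nonneg_left (le_abs_self _) (by positivity)).trans ?_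
      gcongr
    have h2 : (w y / (p * q)) * (q - p) ≤ b / a ^ 2 * |p - q| := by
      rw [abs_sub_comm]
      refine (mul_le_mul_of_nonneg_left (le_abs_self _)
        (div_nonneg (hw0 y) (by positivity))).trans ?_
      rw [sq]
      have := hwb y
      gcongr
    exact add_le_add h1 h2
  have hδ : ∫⁻ z : E × E, (ENNReal.ofReal (w z.1 / p) - ENNReal.ofReal (w z.2 / q)) ∂π ≤
      ENNReal.ofReal (1 / a) * (ENNReal.ofReal L * I)
        + ENNReal.ofReal (b / a ^ 2) * (ENNReal.ofReal L * I) := by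
    refine (lintegral_mono fun z : E × E => hdiff z.1 z.2).trans ?_
    rw [lintegral_add_right _ measurable_const, lintegral_const_mul' _ _ ENNReal.ofReal_ne_top,
      lintegral_const, measure_univ, mul_one]
    gcongr
  calc ENNReal.ofReal (b / a) * I
        + ENNReal.ofReal D *
          ∫⁻ z : E × E, (ENNReal.ofReal (w z.1 / p) - ENNReal.ofReal (w z.2 / q)) ∂π
      ≤ ENNReal.ofReal (b / a) * I + ENNReal.ofReal D *
          (ENNReal.ofReal (1 / a) * (ENNReal.ofReal L * I)
            + ENNReal.ofReal (b / a ^ 2) * (ENNReal.ofReal L * I)) := by gcongr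
    _ = (ENNReal.ofReal (b / a) + ENNReal.ofReal D *
          (ENNReal.ofReal (1 / a) * ENNReal.ofReal L
            + ENNReal.ofReal (b / a ^ 2) * ENNReal.ofReal L)) * I := by ring
    _ = c * I := by
      rw [← ENNReal.ofReal_mul (by positivity), ← ENNReal.ofReal_mul (by positivity),
        ← ENNReal.ofReal_add (by positivity) (by positivity), ← ENNReal.ofReal_mul hD0,
        ← ENNReal.ofReal_add (by positivity) (by positivity), hc]
      congr 2
      field_simp
      ring

end Coupling

/-! ### Entropic projection and exponential tilting. -/

section Duality

variable {E : Type*} [MeasurableSpace E] {k : ℕ} {Φ : E → EuclideanSpace ℝ (Fin k)}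

theorem integrable_exp_inner (P : Measure E) [IsFiniteMeasure P] (hΦ : Measurable Φ) {R : ℝ}
    (hR : ∀ x, ‖Φ x‖ ≤ R) (ξ : EuclideanSpace ℝ (Fin k)) :
    Integrable (fun x => Real.exp ⟪ξ, Φ x⟫) P := by
  refine Integrable.of_bound (measurable_const.inner hΦ).exp.aestronglyMeasurable
    (Real.exp (‖ξ‖ * R)) (ae_of_all _ fun x => ?_)
  rw [Real.norm_eq_abs, Real.abs_exp, Real.exp_le_exp]
  exact (real_inner_le_norm _ _).trans (mul_le_mul_of_nonneg_left (hR x) (norm_nonneg _))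

theorem tiltedModel_eq_withDensity_div (P : Measure E) [IsProbabilityMeasure P]
    (hΦ : Measurable Φ) {R : ℝ} (hR : ∀ x, ‖Φ x‖ ≤ R) (ξ : EuclideanSpace ℝ (Fin k)) :
    tiltedModel P Φ ξ = P.withDensity fun x =>
      ENNReal.ofReal (Real.exp ⟪ξ, Φ x⟫ / ∫ y, Real.exp ⟪ξ, Φ y⟫ ∂P) := by
  have hpos := integral_exp_pos (integrable_exp_inner P hΦ hR ξ)
  simp only [tiltedModel, logPartition, Real.exp_sub, Real.exp_log hpos]

theorem tiltedModel_eq_tilted (P : Measure E) [IsProbabilityMeasure P]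
    (hΦ : Measurable Φ) {R : ℝ} (hR : ∀ x, ‖Φ x‖ ≤ R) (ξ : EuclideanSpace ℝ (Fin k)) :
    tiltedModel P Φ ξ = P.tilted fun x => ⟪ξ, Φ x⟫ :=
  tiltedModel_eq_withDensity_div P hΦ hR ξ

theorem integrable_of_norm_le_const (P : Measure E) [IsFiniteMeasure P] (hΦ : Measurable Φ)
    {R : ℝ} (hR : ∀ x, ‖Φ x‖ ≤ R) : Integrable Φ P :=
  Integrable.of_bound hΦ.aestronglyMeasurable R (ae_of_all _ hR)

/-- Reduces the first-order condition in direction v to the derivative at 0 of a one-variable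
cumulant generating function, which is a mean under the tilted measure. -/
theorem logPartition_add_smul (P : Measure E) [IsProbabilityMeasure P] (hΦ : Measurable Φ)
    {R : ℝ} (hR : ∀ x, ‖Φ x‖ ≤ R) (ξ v : EuclideanSpace ℝ (Fin k)) (s : ℝ) :
    logPartition P Φ (ξ + s • v) = logPartition P Φ ξ
      + ProbabilityTheory.cgf (fun x => ⟪v, Φ x⟫) (P.tilted fun x => ⟪ξ, Φ x⟫) s := by
  have h1 := integral_exp_pos (integrable_exp_inner P hΦ hR ξ)
  have h2 := integral_exp_pos (integrable_exp_inner P hΦ hR (ξ + s • v))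
  have e : ∀ x, ((fun x => ⟪ξ, Φ x⟫) + fun x => s * ⟪v, Φ x⟫) x = ⟪ξ + s • v, Φ x⟫ := fun x => by
    simp [inner_add_left, inner_smul_left]
  rw [ProbabilityTheory.cgf, ProbabilityTheory.mgf, integral_exp_tilted]
  simp only [e]
  rw [Real.log_div h2.ne' h1.ne', logPartition, logPartition]
  ring

/-- First-order condition: the tilted measure at a dual parameter has the prescribed moments. -/
theorem integral_tilted_of_isDualParameter (P : Measure E) [IsProbabilityMeasure P]
    (hΦ : Measurable Φ) {R : ℝ} (hR : ∀ x, ‖Φ x‖ ≤ R) {t ξ : EuclideanSpace ℝ (Fin k)}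
    (hξ : IsDualParameter P Φ t ξ) :
    ∫ x, Φ x ∂(P.tilted fun x => ⟪ξ, Φ x⟫) = t := by
  have hexp := integrable_exp_inner P hΦ hR ξ
  have := isProbabilityMeasure_tilted hexp
  set T := P.tilted fun x => ⟪ξ, Φ x⟫ with hT
  refine ext_inner_left ℝ fun v => ?_
  rw [← integral_inner (integrable_of_norm_le_const T hΦ hR)]
  have h0 : (0 : ℝ) ∈ interior (ProbabilityTheory.integrableExpSet (fun x => ⟪v, Φ x⟫) T) := by
    have : ProbabilityTheory.integrableExpSet (fun x => ⟪v, Φ x⟫) T = Set.univ := by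
      refine Set.eq_univ_of_forall fun s => ?_
      have := integrable_exp_inner T hΦ hR (s • v)
      simpa [ProbabilityTheory.integrableExpSet, inner_smul_left] using this
    simp [this]
  have hmin : IsLocalMin
      (fun s : ℝ => ProbabilityTheory.cgf (fun x => ⟪v, Φ x⟫) T s - s * ⟪v, t⟫) 0 := by
    refine Filter.Eventually.of_forall fun s => ?_
    have h := hξ (ξ + s • v)
    rw [logPartition_add_smul P hΦ hR, inner_add_left, real_inner_smul_left] at h
    simp only [ProbabilityTheory.cgf_zero, zero_mul, sub_zero]
    linarith
  have hder := ((ProbabilityTheory.analyticAt_cgf h0).differentiableAt.hasDerivAt).sub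
    ((hasDerivAt_id (0 : ℝ)).mul_const ⟪v, t⟫)
  have hzero := hmin.hasDerivAt_eq_zero hder
  rw [ProbabilityTheory.deriv_cgf_zero h0] at hzero
  simp only [probReal_univ, div_one, one_mul] at hzero
  linarith

/-- The entropic projection onto the moment constraint is the tilted measure at any dual
parameter. -/
theorem IsEntropicProjection.eq_tiltedModel {P : Measure E} [IsProbabilityMeasure P]
    (hΦ : Measurable Φ) {R : ℝ} (hR : ∀ x, ‖Φ x‖ ≤ R) {t ξ : EuclideanSpace ℝ (Fin k)}
    (hξ : IsDualParameter P Φ t ξ) {Q : Measure E} (hQ : IsEntropicProjection P Φ t Q) :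
    Q = tiltedModel P Φ ξ := by
  rw [tiltedModel_eq_tilted P hΦ hR]
  obtain ⟨⟨hQprob, hQP, hQint, hQt⟩, hQmin⟩ := hQ
  have hexp := integrable_exp_inner P hΦ hR ξ
  have hTprob := isProbabilityMeasure_tilted hexp
  have hTt := integral_tilted_of_isDualParameter P hΦ hR hξ
  set T := P.tilted fun x => ⟪ξ, Φ x⟫ with hT
  have hTP : T ≪ P := tilted_absolutelyContinuous _ _
  have hPT : P ≪ T := absolutelyContinuous_tilted hexp
  have hinner : ∀ S : Measure E, [IsProbabilityMeasure S] → ∫ x, Φ x ∂S = t →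
      Integrable (fun x => ⟪ξ, Φ x⟫) S ∧ ∫ x, ⟪ξ, Φ x⟫ ∂S = ⟪ξ, t⟫ := fun S _ hS => by
    have hi := integrable_of_norm_le_const S hΦ hR
    exact ⟨hi.const_inner ξ, by rw [integral_inner hi, hS]⟩
  have hTllr : Integrable (llr T P) T := by
    have h : llr T P =ᵐ[T] fun x => ⟪ξ, Φ x⟫ - Real.log (∫ x, Real.exp ⟪ξ, Φ x⟫ ∂P) :=
      hTP.ae_le (log_rnDeriv_tilted_left_self hexp)
    rw [integrable_congr h]
    exact (hinner T hTt).1.sub (integrable_const _)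
  have hkl := hQmin T ⟨hTprob, hTP, integrable_of_norm_le_const T hΦ hR, hTt⟩
  -- T is feasible with finite divergence, so minimality forces the divergence of Q to be finite
  -- too.
  have hTtop := klDiv_ne_top hTP hTllr
  have hQllr : Integrable (llr Q P) Q := (klDiv_ne_top_iff.1 (ne_top_of_le_ne_top hTtop hkl)).2
  have hreal := ENNReal.toReal_mono hTtop hkl
  rw [toReal_klDiv_of_measure_eq hQP (by simp), toReal_klDiv_of_measure_eq hTP (by simp)] at hreal
  -- Q and T give ⟪ξ, Φ⟫ the same mean, so subtracting the two identities leaves KL(Q‖T) = KL(Q‖P) -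
  -- KL(T‖P), which is at most 0.
  have eQ := integral_llr_tilted_right hQP (hinner Q hQt).1 hexp hQllr
  have eT := integral_llr_tilted_right hTP (hinner T hTt).1 hexp hTllr
  rw [(hinner Q hQt).2] at eQ
  rw [(hinner T hTt).2, integral_congr_ae (llr_self T)] at eT
  simp only [Pi.zero_apply, integral_zero] at eT
  have hQT : Q ≪ T := hQP.trans hPT
  have hQTllr := integrable_llr_tilted_right hQP (hinner Q hQt).1 hQllr hexp
  rw [← klDiv_eq_zero_iff, klDiv_of_ac_of_integrable hQT hQTllr, ENNReal.ofReal_eq_zero]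
  simp only [probReal_univ]
  rw [eQ]
  linarith

end Duality

/-! ### Bounds for the exponential weight and conclusion. -/

theorem isProbabilityMeasure_empiricalMeasure {E : Type*} [MeasurableSpace E] {n : ℕ} (hn : 0 < n)
    (X : Fin n → E) : IsProbabilityMeasure (empiricalMeasure X) := by
  constructor
  simp only [empiricalMeasure, Measure.smul_apply, Measure.coe_finsetSum, Finset.sum_apply,
    measure_univ, Finset.sum_const, Finset.card_univ, Fintype.card_fin, nsmul_eq_mul, mul_one,
    smul_eq_mul]
  exact ENNReal.inv_mul_cancel (by exact_mod_cast hn.ne') (ENNReal.natCast_ne_top n)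

theorem norm_le_paramBound {k : ℕ} {Ξ : Set (EuclideanSpace ℝ (Fin k))}
    (hΞ : Bornology.IsBounded Ξ) {ξ : EuclideanSpace ℝ (Fin k)} (hξ : ξ ∈ Ξ) :
    ‖ξ‖ ≤ paramBound Ξ := by
  obtain ⟨C, hC⟩ := hΞ.exists_norm_le
  exact le_csSup ⟨C, by rintro _ ⟨x, hx, rfl⟩; exact hC x hx⟩ ⟨ξ, hξ, rfl⟩

/-- By convexity the graph of exp lies above its tangent at the larger of the two points, whose
slope is at most exp c. -/
theorem abs_exp_sub_exp_le {s t c : ℝ} (hs : s ≤ c) (ht : t ≤ c) :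
    |Real.exp s - Real.exp t| ≤ Real.exp c * |s - t| := by
  wlog h : t ≤ s generalizing s t
  · rw [abs_sub_comm, abs_sub_comm s]
    exact this ht hs (le_of_not_ge h)
  rw [abs_of_nonneg (sub_nonneg.2 (Real.exp_le_exp.2 h)), abs_of_nonneg (sub_nonneg.2 h)]
  have h1 : Real.exp s * (t - s + 1) ≤ Real.exp t := by
    calc Real.exp s * (t - s + 1) ≤ Real.exp s * Real.exp (t - s) := by
          gcongr; exact Real.add_one_le_exp _
      _ = Real.exp t := by rw [← Real.exp_add]; ring_nf
  have h2 : Real.exp s * (s - t) ≤ Real.exp c * (s - t) :=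
    mul_le_mul_of_nonneg_right (Real.exp_le_exp.2 hs) (sub_nonneg.2 h)
  linarith

/-- Stability of exponential reweighting in `W1`, for arbitrary probability measures. -/
theorem W1_tiltedModel_le {E : Type*} [MetricSpace E] [MeasurableSpace E] [BorelSpace E]
    {D : ℝ} (hD : ∀ x y : E, dist x y ≤ D) {k : ℕ} {Φ : E → EuclideanSpace ℝ (Fin k)}
    {R : ℝ} (hΦR : ∀ x, ‖Φ x‖ ≤ R) {LΦ : ℝ≥0} (hΦL : LipschitzWith LΦ Φ)
    (μ ν : Measure E) [IsProbabilityMeasure μ] [IsProbabilityMeasure ν]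
    {Ξ : Set (EuclideanSpace ℝ (Fin k))} (hΞ : Bornology.IsBounded Ξ)
    {ξ : EuclideanSpace ℝ (Fin k)} (hξ : ξ ∈ Ξ) :
    W1 (tiltedModel μ Φ ξ) (tiltedModel ν Φ ξ) ≤
      ENNReal.ofReal (stabilityConst Ξ R LΦ D) * W1 μ ν := by
  have hΦ : Measurable Φ := hΦL.continuous.measurable
  have hB := norm_le_paramBound hΞ hξ
  have hB0 : 0 ≤ paramBound Ξ := (norm_nonneg _).trans hB
  have habs : ∀ x, |⟪ξ, Φ x⟫| ≤ paramBound Ξ * R := fun x =>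
    (abs_real_inner_le_norm _ _).trans (mul_le_mul hB (hΦR x) (norm_nonneg _) hB0)
  rw [tiltedModel_eq_withDensity_div μ hΦ hΦR, tiltedModel_eq_withDensity_div ν hΦ hΦR]
  refine W1_withDensity_normalized_le hD (w := fun x => Real.exp ⟪ξ, Φ x⟫)
    (measurable_const.inner hΦ).exp (Real.exp_pos _)
    (fun x => Real.exp_le_exp.2 (abs_le.1 (habs x)).1)
    (fun x => Real.exp_le_exp.2 (abs_le.1 (habs x)).2)
    (by rw [weightLip]; positivity) fun x y => ?_
  refine (abs_exp_sub_exp_le (abs_le.1 (habs x)).2 (abs_le.1 (habs y)).2).trans ?_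
  have h : |⟪ξ, Φ x⟫ - ⟪ξ, Φ y⟫| ≤ paramBound Ξ * (LΦ * dist x y) := by
    rw [← inner_sub_right]
    refine (abs_real_inner_le_norm _ _).trans (mul_le_mul hB ?_ (norm_nonneg _) hB0)
    rw [← dist_eq_norm]
    exact hΦL.dist_le_mul x y
  calc _ ≤ Real.exp (paramBound Ξ * R) * (paramBound Ξ * (LΦ * dist x y)) := by gcongr
    _ = weightLip Ξ R LΦ * dist x y := by rw [weightLip]; ring

end EPA

theorem mainTheorem10 {E : Type*} [MetricSpace E] [MeasurableSpace E] [BorelSpace E]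
    (D : ℝ) (hD : ∀ x y : E, dist x y ≤ D)
    {k : ℕ} (Φ : E → EuclideanSpace ℝ (Fin k))
    (R : ℝ) (hR : 0 < R) (hΦR : ∀ x, ‖Φ x‖ ≤ R)
    (LΦ : ℝ≥0) (hΦL : LipschitzWith LΦ Φ)
    (PX : Measure E) [IsProbabilityMeasure PX]
    {n m : ℕ} (hn : 0 < n) (hm : 0 < m) (X : Fin n → E) (Z : Fin m → E)
    (Ξ : Set (EuclideanSpace ℝ (Fin k))) (hΞ : Bornology.IsBounded Ξ)
    (ξhat : EuclideanSpace ℝ (Fin k)) (hξΞ : ξhat ∈ Ξ)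
    (hξ : EPA.IsDualParameter (EPA.empiricalMeasure X) Φ (EPA.empiricalMoment Φ Z) ξhat)
    (Phat : Measure E)
    (hPhat : EPA.IsEntropicProjection (EPA.empiricalMeasure X) Φ (EPA.empiricalMoment Φ Z) Phat) :
    EPA.W1 (EPA.tiltedModel PX Φ ξhat) Phat ≤
      ENNReal.ofReal (EPA.stabilityConst Ξ R LΦ D) * EPA.W1 PX (EPA.empiricalMeasure X) := by
  have := EPA.isProbabilityMeasure_empiricalMeasure hn X
  rw [hPhat.eq_tiltedModel hΦL.continuous.measurable hΦR hξ]
  exact EPA.W1_tiltedModel_le hD hΦR hΦL PX (EPA.empiricalMeasure X) hΞ hξΞ
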